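/- Let $X$ and $Y$ be (real) Fréchet spaces, i.e. locally convex topological vector spaces whose topology is generated by a complete translation-invariant metric, and let $(P_k)_{k\in\mathbb N}$, $(Q_k)_{k\in\mathbb N}$ be sequences of continuous linear operators of finite rank on $X$ and $Y$, respectively, with $P_kx\to x$ for every $x\in X$ and $Q_ky\to y$ for every $y\in Y$. Let $c:X\times Y\to[0,+\infty]$ be lower semicontinuous. For Borel probability measures $\mu$ on $X$ and $\nu$ on $Y$ let $$\mathscr C_c(\mu,\nu)=\inf_{\gamma}\int_{X\times Y}c\,\mathrm d\gamma\in[0,+\infty],$$ where $\gamma$ runs over the Borel probability measures on $X\times Y$ with marginals $\mu$ and $\nu$. For a cost $\tilde c:X\times Y\to[0,+\infty]$ and $\delta>0$ let $\Phi^\delta_{\tilde c}$ be the set of pairs $(\phi,\psi)$ of bounded continuous functions $\phi:X\to\mathbb R$, $\psi:Y\to\mathbb R$ such that $\phi(x)+\psi(y)\le\tilde c(x,y)$ for $\mu$-almost every $x$ and $\nu$-almost every $y$ (i.e. for all $x$ outside a $\mu$-null set and all $y$ outside a $\nu$-null set) and $$-\delta\le\inf_X\phi\le0,\qquad \sup_X\phi\le\sup_{X\times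 Y}\tilde c,\qquad \psi\ge-\sup_X\phi-\delta,\qquad \sup_Y\psi\ge-\delta.$$ For a continuous finite-rank operator $P$ on $X$, let $\mathrm{Cyl}(X;P)$ be the set of functions $\varphi\circ P$ with $\varphi$ a smooth compactly supported function on $P[X]$, where $P[X]$ is identified with a Euclidean space $\mathbb R^n$ through a linear homeomorphism; define $\mathrm{Cyl}(Y;Q)$ in the same way. Assume that for every $k$ the restriction of $c$ to $P_k[X]\times Q_k[Y]$ is locally coercive: after identification of $P_k[X]$ and $Q_k[Y]$ with Euclidean spaces, for all $R,\delta',M>0$ there is an $R'>0$ such that, for $x\in P_k[X]$ and $y\in Q_k[Y]$, $$|x|<R\quad\text{and}\quad c(x,y)<\min\Big\{\sup_{\eta\in Q_k[Y]}c(x,\eta)-\delta',\,M\Big\}\qquad\text{imply}\qquad |y|<R'.$$ Put $c_k(x,y)=c(P_kx,Q_ky)$. Then for all Borel probability measures $\mu$ on $X$ and $\nu$ on $Y$ and every $\delta>0$, $$\mathscr C_c(\mu,\nu)\le\liminf_{k\to\infty}\ \sup\Big\{\int_X\phi\,\mathrm d\mu+\int_Y\psi\,\mathrm d\nu\ :\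 (\phi,\psi)\in\Phi^\delta_{c_k}\cap\big(\mathrm{Cyl}(X;P_k)\times\mathrm{Cyl}(Y;Q_k)\big)\Big\}.$$ -/

import Mathlib

open MeasureTheory Filter Topology
open scoped ENNReal ContDiff

noncomputable section

/-- A Fréchet space: a locally convex real topological vector space whose topology is generated by
a translation invariant metric which makes the space complete. -/
class IsFrechetSpace (X : Type*) [AddCommGroup X] [Module ℝ X] [t : TopologicalSpace X] : Prop
    extends IsTopologicalAddGroup X, ContinuousSMul ℝ X, LocallyConvexSpace ℝ X where
  exists_metric : ∃ m : MetricSpace X,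
    m.toPseudoMetricSpace.toUniformSpace.toTopologicalSpace = t ∧
    (∀ x y z : X, m.dist (x + z) (y + z) = m.dist x y) ∧
    @CompleteSpace X m.toPseudoMetricSpace.toUniformSpace

/-- The Monge-Kantorovich cost: the infimum of `∫ c dγ` over all couplings `γ` of `μ` and `ν`. -/
def transportCost {X Y : Type*} [MeasurableSpace X] [MeasurableSpace Y]
    (c : X × Y → ℝ≥0∞) (μ : Measure X) (ν : Measure Y) : ℝ≥0∞ :=
  ⨅ γ ∈ {γ : Measure (X × Y) | γ.map Prod.fst = μ ∧ γ.map Prod.snd = ν}, ∫⁻ p, c p ∂γ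

/-- The set `Φ_c` of admissible pairs: integrable `φ`, `ψ` with `φ(x) + ψ(y) ≤ c(x, y)` for
`μ`-almost every `x` and `ν`-almost every `y`, that is, off a `μ`-null set of points `x` and a
`ν`-null set of points `y`. -/
def admissiblePairs {X Y : Type*} [MeasurableSpace X] [MeasurableSpace Y]
    (c : X × Y → ℝ≥0∞) (μ : Measure X) (ν : Measure Y) : Set ((X → ℝ) × (Y → ℝ)) :=
  {p | Integrable p.1 μ ∧ Integrable p.2 ν ∧
    ∃ A ∈ ae μ, ∃ B ∈ ae ν, ∀ x ∈ A, ∀ y ∈ B, ((p.1 x + p.2 y : ℝ) : EReal) ≤ (c (x, y) : EReal)}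

/-- The set `Φ_c^δ` of bounded continuous admissible pairs `(φ, ψ)` such that
`-δ ≤ inf φ ≤ 0`, `sup φ ≤ sup c`, `ψ ≥ -sup φ - δ` and `sup ψ ≥ -δ`.
All suprema and infima are taken in the extended reals. -/
def relaxedPairs {X Y : Type*} [TopologicalSpace X] [TopologicalSpace Y]
    [MeasurableSpace X] [MeasurableSpace Y]
    (c : X × Y → ℝ≥0∞) (μ : Measure X) (ν : Measure Y) (δ : ℝ) : Set ((X → ℝ) × (Y → ℝ)) :=
  {p | p ∈ admissiblePairs c μ ν ∧
    Continuous p.1 ∧ (∃ K : ℝ, ∀ x, |p.1 x| ≤ K) ∧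
    Continuous p.2 ∧ (∃ K : ℝ, ∀ y, |p.2 y| ≤ K) ∧
    ((-δ : ℝ) : EReal) ≤ (⨅ x, (p.1 x : EReal)) ∧
    (⨅ x, (p.1 x : EReal)) ≤ 0 ∧
    (⨆ x, (p.1 x : EReal)) ≤ (⨆ q : X × Y, (c q : EReal)) ∧
    (∀ y, -(⨆ x, (p.1 x : EReal)) - (δ : EReal) ≤ (p.2 y : EReal)) ∧
    ((-δ : ℝ) : EReal) ≤ (⨆ y, (p.2 y : EReal))}

/-- Local coercivity of a cost on a product of two Euclidean spaces. The subtraction is truncated,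
which is immaterial: the inequality `c (x, y) < ...` fails whenever its right hand side is `≤ 0`. -/
def LocallyCoercive {m n : ℕ}
    (c : EuclideanSpace ℝ (Fin m) × EuclideanSpace ℝ (Fin n) → ℝ≥0∞) : Prop :=
  ∀ R > (0 : ℝ), ∀ δ > (0 : ℝ), ∀ M > (0 : ℝ), ∃ R' > (0 : ℝ), ∀ x y, ‖x‖ < R →
    c (x, y) < min ((⨆ η, c (x, η)) - ENNReal.ofReal δ) (ENNReal.ofReal M) → ‖y‖ < R'

/-- The restriction of `c` to `E × F`, for finite dimensional subspaces `E` and `F`, is locally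
coercive after identification of `E` and `F` with Euclidean spaces. (Whether this holds does not
depend on the identifications.) -/
def LocallyCoerciveOn {X Y : Type*} [AddCommGroup X] [Module ℝ X] [TopologicalSpace X]
    [AddCommGroup Y] [Module ℝ Y] [TopologicalSpace Y]
    (c : X × Y → ℝ≥0∞) (E : Submodule ℝ X) (F : Submodule ℝ Y) : Prop :=
  ∃ (m n : ℕ) (ι : E ≃L[ℝ] EuclideanSpace ℝ (Fin m)) (κ : F ≃L[ℝ] EuclideanSpace ℝ (Fin n)),
    LocallyCoercive fun p => c ((ι.symm p.1 : X), (κ.symm p.2 : Y))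

/-- `Cyl(X; P)`: the functions `φ ∘ P` with `φ` smooth and compactly supported on the range of `P`,
where that range is identified with a Euclidean space by a linear homeomorphism. -/
def Cyl {X : Type*} [AddCommGroup X] [Module ℝ X] [TopologicalSpace X] (P : X →L[ℝ] X) :
    Set (X → ℝ) :=
  {f | ∃ (n : ℕ) (ι : LinearMap.range (P : X →ₗ[ℝ] X) ≃L[ℝ] EuclideanSpace ℝ (Fin n))
    (φ : EuclideanSpace ℝ (Fin n) → ℝ), ContDiff ℝ ∞ φ ∧ HasCompactSupport φ ∧
      ∀ x, f x = φ (ι ⟨P x, LinearMap.mem_range_self (P : X →ₗ[ℝ] X) x⟩)}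

end

open scoped BoundedContinuousFunction CompactlySupported Manifold

/-! The cost `c` itself is never approximated; only the marginals move. The cost `c_k` sees a point
only through `P_k` and `Q_k`, so its dual problem is the dual problem for `c` restricted to the
finite dimensional space `P_k[X] × Q_k[Y]`, with marginals the images of `μ` and `ν`. If the
constrained smooth cylindrical dual value is at most a real `S`, some plan `γ_k` between these
images satisfies `∫ c dγ_k ≤ S`. The images converge weakly to `μ` and `ν`, so Prokhorov's theorem
yields a limit plan, and lower semicontinuity bounds its cost by `S`.

The finite dimensional step has two halves. `LocallyCoercive.exists_smooth_pair` shows that the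
restriction to smooth compactly supported potentials with the relaxed bounds costs nothing: any
bounded continuous admissible pair can be replaced by such a pair with arbitrarily small loss. This
is where coercivity enters, since a cut-off of a negative potential raises it near infinity.
`exists_coupling_lintegral_le` is Kantorovich duality: M. Riesz extension produces a positive
functional with the right marginals, the marginals force it to be tight, and it is then integration
against a measure. -/

/-! ### Lower semicontinuous integrands, representation of functionals, cut-offs -/

/-- A positive measure integrates a lower semicontinuous function to the supremum of the integrals
of the bounded continuous functions below it. -/
theorem lintegral_le_of_forall_boundedContinuous_le {Ω : Type*} [PseudoEMetricSpace Ω]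
    [MeasurableSpace Ω] [OpensMeasurableSpace Ω] {c : Ω → ℝ≥0∞} (hc : LowerSemicontinuous c)
    (γ : Measure Ω) [IsFiniteMeasure γ] (S : ℝ)
    (hS : ∀ h : Ω →ᵇ ℝ, (∀ p, 0 ≤ h p) → (∀ p, ENNReal.ofReal (h p) ≤ c p) → ∫ p, h p ∂γ ≤ S) :
    ∫⁻ p, c p ∂γ ≤ ENNReal.ofReal S := by
  -- Lipschitz regularisation: the largest `n`-Lipschitz minorant of `min c n`. It increases to `c`
  -- because near `p` semicontinuity keeps `c` above `b`, while away from `p` the penalty `n * edist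
  -- p q` exceeds `b` for large `n`.
  let g : ℕ → Ω → ℝ≥0∞ := fun n p => ⨅ q, (min (c q) n + n * edist p q)
  have gle (n p) : g n p ≤ min (c p) n := by
    refine (iInf_le _ p).trans ?_
    simp
  have gcont (n) : Continuous (g n) := by
    refine continuous_of_le_add_edist n (by simp) fun x y => ?_
    rw [ENNReal.iInf_add]
    refine le_iInf fun q => (iInf_le _ q).trans ?_
    rw [add_assoc, ← mul_add, add_comm (edist y q)]
    gcongr
    exact edist_triangle x y q
  have gmono : Monotone g := fun m n hmn p => iInf_mono fun q => by gcongr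
  have gsup (p) : ⨆ n, g n p = c p := by
    refine le_antisymm (iSup_le fun n => (gle n p).trans (min_le_left _ _)) ?_
    refine le_of_forall_lt fun a ha => ?_
    obtain ⟨b, hab, hb⟩ := exists_between ha
    have hbt : b ≠ ⊤ := hb.ne_top
    obtain ⟨r, hr, hball⟩ := Metric.nhds_basis_eball.mem_iff.1 (hc p b hb)
    obtain ⟨m, hm⟩ := ENNReal.exists_nat_mul_gt hr.ne' hbt
    obtain ⟨m', hm'⟩ := ENNReal.exists_nat_gt hbt
    refine hab.trans_le (le_iSup_of_le (max m m') (le_iInf fun q => ?_))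
    by_cases hq : q ∈ Metric.eball p r
    · refine le_add_right (le_min (hball hq).le (hm'.le.trans ?_))
      exact_mod_cast le_max_right _ _
    · refine le_add_left (hm.le.trans ?_)
      have : r ≤ edist p q := by simpa [edist_comm] using hq
      gcongr
      exact le_max_left _ _
  have gne (n p) : g n p ≠ ⊤ := ne_top_of_le_ne_top (by simp) ((gle n p).trans (min_le_right _ _))
  simp_rw [← gsup]
  rw [lintegral_iSup (fun n => (gcont n).measurable) gmono]
  refine iSup_le fun n => ?_
  let h : Ω →ᵇ ℝ := BoundedContinuousFunction.ofNormedAddCommGroup (fun p => (g n p).toReal)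
    (ENNReal.continuousOn_toReal.comp_continuous (gcont n) (gne n)) n (fun p => by
      rw [Real.norm_of_nonneg ENNReal.toReal_nonneg]
      exact ENNReal.toReal_le_of_le_ofReal (by simp) (by
        simpa using (gle n p).trans (min_le_right _ _)))
  have hh (p) : ENNReal.ofReal (h p) = g n p := ENNReal.ofReal_toReal (gne n p)
  have h0 (p) : 0 ≤ h p := ENNReal.toReal_nonneg
  have := hS h h0 fun p => by rw [hh]; exact (gle n p).trans (min_le_left _ _)
  calc ∫⁻ p, g n p ∂γ = ∫⁻ p, ENNReal.ofReal (h p) ∂γ := by simp_rw [hh]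
    _ = ENNReal.ofReal (∫ p, h p ∂γ) :=
      (ofReal_integral_eq_lintegral_ofReal (h.integrable γ) (.of_forall h0)).symm
    _ ≤ _ := ENNReal.ofReal_le_ofReal this

/-- A positive linear functional on the bounded continuous functions which is tight along a
sequence of compactly supported cut-offs is represented by a finite measure. -/
theorem exists_measure_eq_of_tight_functional {Z : Type*} [TopologicalSpace Z] [T2Space Z]
    [LocallyCompactSpace Z] [MeasurableSpace Z] [BorelSpace Z] (Λ : (Z →ᵇ ℝ) →ₗ[ℝ] ℝ)
    (hΛ : ∀ h : Z →ᵇ ℝ, (∀ z, 0 ≤ h z) → 0 ≤ Λ h)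
    (κ : ℕ → Z →ᵇ ℝ) (hκs : ∀ n, HasCompactSupport (κ n)) (hκ0 : ∀ n z, 0 ≤ κ n z)
    (hκ1 : ∀ n z, κ n z ≤ 1) (hκt : ∀ z, Tendsto (fun n => κ n z) atTop (𝓝 1))
    (hκΛ : Tendsto (fun n => Λ (κ n)) atTop (𝓝 (Λ 1))) :
    ∃ γ : Measure Z, IsFiniteMeasure γ ∧ ∀ h : Z →ᵇ ℝ, ∫ z, h z ∂γ = Λ h := by
  have mono {f g : Z →ᵇ ℝ} (h : ∀ z, f z ≤ g z) : Λ f ≤ Λ g := by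
    have := hΛ (g - f) fun z => by simpa using h z
    rw [map_sub] at this
    linarith
  let ib : C_c(Z, ℝ) → (Z →ᵇ ℝ) := fun f => 
    BoundedContinuousFunction.ofNormedAddCommGroup f f.continuous _
      (f.hasCompactSupport.exists_bound_of_continuous f.continuous).choose_spec
  let L : C_c(Z, ℝ) →ₗ[ℝ] ℝ :=
    { toFun := fun f => Λ (ib f)
      map_add' := fun f g => by
        rw [← map_add]; congr 1
      map_smul' := fun a f => by
        rw [RingHom.id_apply, ← map_smul]; congr 1 }
  let LP : C_c(Z, ℝ) →ₚ[ℝ] ℝ := PositiveLinearMap.mk₀ L fun f hf => hΛ _ fun z => hf z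
  let γ := RealRMK.rieszMeasure LP
  have rep (f : Z →ᵇ ℝ) (hf : HasCompactSupport f) : ∫ z, f z ∂γ = Λ f := by
    have := RealRMK.integral_rieszMeasure LP ⟨f.toContinuousMap, hf⟩
    refine this.trans ?_
    change Λ (ib _) = _
    congr 1
  have fin : IsFiniteMeasure γ := by
    refine ⟨lt_of_le_of_lt (b := ENNReal.ofReal (Λ 1)) ?_ ENNReal.ofReal_lt_top⟩
    -- Fatou's lemma along the cut-offs bounds the total mass by `Λ 1`.
    have key : ∫⁻ _, 1 ∂γ ≤ liminf (fun n => ∫⁻ z, ENNReal.ofReal (κ n z) ∂γ) atTop := by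
      refine le_trans (le_of_eq ?_) (lintegral_liminf_le fun n =>
        ((κ n).continuous.measurable).ennreal_ofReal)
      refine lintegral_congr fun z => ?_
      have := (ENNReal.continuous_ofReal.tendsto 1).comp (hκt z)
      rw [ENNReal.ofReal_one] at this
      exact this.liminf_eq.symm
    rw [lintegral_one] at key
    refine key.trans (liminf_le_of_le (by isBoundedDefault) fun b hb => ?_)
    obtain ⟨n, hn⟩ := hb.exists
    refine hn.trans ?_
    rw [← ofReal_integral_eq_lintegral_ofReal
      ((κ n).continuous.integrable_of_hasCompactSupport (hκs n)) (.of_forall (hκ0 n)),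
      rep _ (hκs n)]
    exact ENNReal.ofReal_le_ofReal (mono (hκ1 n))
  refine ⟨γ, fin, fun h => ?_⟩
  have t1 : Tendsto (fun n => ∫ z, (h * κ n) z ∂γ) atTop (𝓝 (∫ z, h z ∂γ)) := by
    refine tendsto_integral_of_dominated_convergence (fun _ => ‖h‖)
      (fun n => (h * κ n).continuous.measurable.aestronglyMeasurable) (integrable_const _)
      (fun n => .of_forall fun z => ?_) (.of_forall fun z => ?_)
    · rw [BoundedContinuousFunction.mul_apply, norm_mul]
      refine (mul_le_mul (h.norm_coe_le_norm z) ?_ (norm_nonneg _) (norm_nonneg _)).trans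
        (mul_one _).le
      rw [Real.norm_of_nonneg (hκ0 n z)]
      exact hκ1 n z
    · simpa using (hκt z).const_mul (h z)
  have hcs (n) : HasCompactSupport (h * κ n) := by
    rw [BoundedContinuousFunction.coe_mul]
    exact (hκs n).mul_left
  simp_rw [fun n => rep (h * κ n) (hcs n)] at t1
  refine tendsto_nhds_unique t1 ?_
  -- Positivity turns `|h - h κ_n| ≤ ‖h‖ (1 - κ_n)` into a bound for `Λ (h κ_n) - Λ h`.
  have t2 : Tendsto (fun n => ‖h‖ * (Λ 1 - Λ (κ n))) atTop (𝓝 0) := by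
    simpa using (hκΛ.const_sub (Λ 1)).const_mul ‖h‖
  refine tendsto_iff_norm_sub_tendsto_zero.2
    (squeeze_zero (fun _ => norm_nonneg _) (fun n => ?_) t2)
  have e : ‖h‖ * (Λ 1 - Λ (κ n)) = Λ (‖h‖ • (1 - κ n)) := by rw [map_smul, map_sub, smul_eq_mul]
  rw [← map_sub, e, Real.norm_eq_abs, abs_le, ← map_neg]
  have bd (z) := abs_le.1 (h.norm_coe_le_norm z)
  constructor
  · refine mono fun z => ?_
    have := hκ1 n z
    have := bd z
    simp
    nlinarith
  · refine mono fun z => ?_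
    have := hκ1 n z
    have := bd z
    simp
    nlinarith

/-- Continuous compactly supported cut-off functions exhausting a proper space. -/
theorem exists_seq_cutoff {E : Type*} [PseudoMetricSpace E] [ProperSpace E] (x₀ : E) :
    ∃ χ : ℕ → E →ᵇ ℝ, (∀ n, HasCompactSupport (χ n)) ∧ (∀ n x, 0 ≤ χ n x) ∧
      (∀ n x, χ n x ≤ 1) ∧ (∀ (n : ℕ) x, dist x x₀ ≤ n → χ n x = 1) ∧
      ∀ x, Tendsto (fun n => χ n x) atTop (𝓝 1) := by
  let f : ℕ → E → ℝ := fun n x => max 0 (min 1 (n + 1 - dist x x₀))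
  have f0 (n x) : 0 ≤ f n x := le_max_left _ _
  have f1 (n x) : f n x ≤ 1 := max_le zero_le_one (min_le_left _ _)
  have fe (n : ℕ) (x : E) (h : dist x x₀ ≤ n) : f n x = 1 := by
    simp only [f]
    rw [min_eq_left (by linarith)]
    simp
  refine ⟨fun n => BoundedContinuousFunction.ofNormedAddCommGroup (f n) (by fun_prop) 1 fun x => by
    rw [Real.norm_of_nonneg (f0 n x)]; exact f1 n x, fun n => ?_, f0, f1, fe, fun x => ?_⟩
  · refine HasCompactSupport.intro (isCompact_closedBall x₀ (n + 1)) fun x hx => ?_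
    have : (n : ℝ) + 1 < dist x x₀ := by simpa using hx
    change max 0 (min 1 (n + 1 - dist x x₀)) = 0
    exact max_eq_left ((min_le_right _ _).trans (by linarith))
  · obtain ⟨m, hm⟩ := exists_nat_ge (dist x x₀)
    refine tendsto_const_nhds.congr' ?_
    filter_upwards [eventually_ge_atTop m] with n hn
    exact (fe n x (hm.trans (by exact_mod_cast hn))).symm

theorem tendsto_integral_cutoff {E : Type*} [TopologicalSpace E] [MeasurableSpace E]
    [OpensMeasurableSpace E] (μ : Measure E) [IsFiniteMeasure μ] {χ : ℕ → E →ᵇ ℝ}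
    (h0 : ∀ n x, 0 ≤ χ n x) (h1 : ∀ n x, χ n x ≤ 1)
    (ht : ∀ x, Tendsto (fun n => χ n x) atTop (𝓝 1)) (φ : E →ᵇ ℝ) :
    Tendsto (fun n => ∫ x, φ x * χ n x ∂μ) atTop (𝓝 (∫ x, φ x ∂μ)) := by
  refine tendsto_integral_of_dominated_convergence (fun _ => ‖φ‖)
    (fun n => (φ * χ n).continuous.measurable.aestronglyMeasurable) (integrable_const _)
    (fun n => .of_forall fun z => ?_) (.of_forall fun z => ?_)
  · rw [norm_mul]
    refine (mul_le_mul (φ.norm_coe_le_norm z) ?_ (norm_nonneg _) (norm_nonneg _)).trans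
      (mul_one _).le
    rw [Real.norm_of_nonneg (h0 n z)]
    exact h1 n z
  · simpa using (ht z).const_mul (φ z)

/-! ### Kantorovich duality on proper spaces -/

/-- If all admissible pairs of bounded continuous potentials have value at most `S`, then some
positive linear functional with marginals `μ` and `ν` is at most `S` on every function below `c`. -/
theorem exists_functional_of_forall_pair_le {E F : Type*} [TopologicalSpace E] [TopologicalSpace F]
    [MeasurableSpace E] [OpensMeasurableSpace E] [MeasurableSpace F] [OpensMeasurableSpace F]
    (c : E × F → ℝ≥0∞) (μ : Measure E) [IsProbabilityMeasure μ] (ν : Measure F)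
    [IsProbabilityMeasure ν] (S : ℝ)
    (hS : ∀ (φ : E →ᵇ ℝ) (ψ : F →ᵇ ℝ), (∀ x y, ENNReal.ofReal (φ x + ψ y) ≤ c (x, y)) →
      ∫ x, φ x ∂μ + ∫ y, ψ y ∂ν ≤ S) :
    ∃ Λ : (E × F →ᵇ ℝ) →ₗ[ℝ] ℝ, (∀ h : E × F →ᵇ ℝ, (∀ p, 0 ≤ h p) → 0 ≤ Λ h) ∧
      (∀ (φ : E →ᵇ ℝ) (ψ : F →ᵇ ℝ) (h : E × F →ᵇ ℝ), (∀ x y, h (x, y) = φ x + ψ y) →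
        Λ h = ∫ x, φ x ∂μ + ∫ y, ψ y ∂ν) ∧
      ∀ h : E × F →ᵇ ℝ, (∀ p, ENNReal.ofReal (h p) ≤ c p) → Λ h ≤ S := by
  let W := ((E →ᵇ ℝ) × (F →ᵇ ℝ)) × ((E × F →ᵇ ℝ) × ℝ)
  -- The cone of `((φ, ψ), (h, s))` with `s ≥ 0` and `φ + ψ + h + s c ≥ 0`. The coordinate `s`
  -- stands for the multiple of `c`, which need not be finite or continuous; since `0 * ⊤ = 0`, the
  -- case `s = 0` really means `φ + ψ + h ≥ 0`.
  let K : PointedCone ℝ W :=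
    { carrier := {w | 0 ≤ w.2.2 ∧ ∀ x y, ENNReal.ofReal (-(w.1.1 x + w.1.2 y + w.2.1 (x, y))) ≤
        ENNReal.ofReal w.2.2 * c (x, y)}
      zero_mem' := by simp
      add_mem' := by
        rintro v w ⟨hv, hv'⟩ ⟨hw, hw'⟩
        refine ⟨add_nonneg hv hw, fun x y => ?_⟩
        change _ ≤ ENNReal.ofReal (v.2.2 + w.2.2) * _
        rw [ENNReal.ofReal_add hv hw, add_mul]
        refine le_trans (le_of_eq ?_) (ENNReal.ofReal_add_le.trans (add_le_add (hv' x y) (hw' x y)))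
        congr 1
        change -((v.1.1 x + w.1.1 x) + (v.1.2 y + w.1.2 y) + (v.2.1 (x, y) + w.2.1 (x, y))) = _
        ring
      smul_mem' := by
        rintro ⟨a, ha⟩ w ⟨hw, hw'⟩
        refine ⟨mul_nonneg ha hw, fun x y => ?_⟩
        change _ ≤ ENNReal.ofReal (a * w.2.2) * _
        rw [ENNReal.ofReal_mul ha, mul_assoc]
        refine le_trans (le_of_eq ?_) (mul_le_mul_right (hw' x y) _)
        rw [← ENNReal.ofReal_mul ha]
        congr 1
        change -(a * w.1.1 x + a * w.1.2 y + a * w.2.1 (x, y)) = _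
        ring }
  let f₀ : W →ₗ[ℝ] ℝ :=
    { toFun := fun w => ∫ x, w.1.1 x ∂μ + ∫ y, w.1.2 y ∂ν + w.2.2 * S
      map_add' := fun v w => by
        change ∫ x, (v.1.1 x + w.1.1 x) ∂μ + ∫ y, (v.1.2 y + w.1.2 y) ∂ν + (v.2.2 + w.2.2) * S = _
        rw [integral_add (v.1.1.integrable μ) (w.1.1.integrable μ),
          integral_add (v.1.2.integrable ν) (w.1.2.integrable ν)]
        ring
      map_smul' := fun a w => by
        change ∫ x, a * w.1.1 x ∂μ + ∫ y, a * w.1.2 y ∂ν + (a * w.2.2) * S = a * _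
        rw [integral_const_mul, integral_const_mul]
        ring }
  let D : Submodule ℝ W := LinearMap.ker (LinearMap.fst ℝ (E × F →ᵇ ℝ) ℝ ∘ₗ
    LinearMap.snd ℝ ((E →ᵇ ℝ) × (F →ᵇ ℝ)) ((E × F →ᵇ ℝ) × ℝ))
  -- This is where the bound `S` on the dual values is used: for `s > 0` it is applied to `(-φ/s,
  -- -ψ/s)`.
  have f₀_nonneg (w : W) (hD : w.2.1 = 0) (hK : w ∈ K) : 0 ≤ f₀ w := by
    obtain ⟨⟨φ, ψ⟩, h, s⟩ := w
    obtain ⟨hs, hK⟩ := hK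
    obtain rfl : h = 0 := hD
    change 0 ≤ ∫ x, φ x ∂μ + ∫ y, ψ y ∂ν + s * S
    change 0 ≤ s at hs
    replace hK : ∀ x y, ENNReal.ofReal (-(φ x + ψ y)) ≤ ENNReal.ofReal s * c (x, y) := fun x y => by
      simpa using hK x y
    rcases hs.eq_or_lt with rfl | hs
    · replace hK : ∀ x y, 0 ≤ φ x + ψ y := fun x y => by
        have := hK x y
        rw [ENNReal.ofReal_zero, zero_mul, nonpos_iff_eq_zero, ENNReal.ofReal_eq_zero] at this
        linarith
      have : 0 ≤ ∫ y, (∫ x, φ x ∂μ + ψ y) ∂ν := by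
        refine integral_nonneg fun y => ?_
        have : 0 ≤ ∫ x, (φ x + ψ y) ∂μ := integral_nonneg fun x => hK x y
        rw [integral_add (φ.integrable μ) (integrable_const _)] at this
        simpa using this
      rw [integral_add (integrable_const _) (ψ.integrable ν)] at this
      simpa using this
    · have := hS (-s⁻¹ • φ) (-s⁻¹ • ψ) fun x y => by
        have h1 : (-s⁻¹ • φ) x + (-s⁻¹ • ψ) y = s⁻¹ * -(φ x + ψ y) := by
          simp
          ring
        rw [h1, ENNReal.ofReal_mul (by positivity), ENNReal.ofReal_inv_of_pos hs]
        refine (mul_le_mul_right (hK x y) _).trans ?_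
        rw [← mul_assoc, ENNReal.inv_mul_cancel (by simpa) (by simp), one_mul]
      simp only [BoundedContinuousFunction.coe_smul, smul_eq_mul, integral_const_mul] at this
      have h2 : s * (-s⁻¹ * ∫ x, φ x ∂μ + -s⁻¹ * ∫ y, ψ y ∂ν) ≤ s * S := by gcongr
      have h3 : s * (-s⁻¹ * ∫ x, φ x ∂μ + -s⁻¹ * ∫ y, ψ y ∂ν)
        = -(∫ x, φ x ∂μ + ∫ y, ψ y ∂ν) := by field_simp; ring
      linarith
  -- A large constant in the first slot, together with `|s|`, moves any vector into the cone, as the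
  -- extension theorem requires.
  obtain ⟨g, hgf, hg⟩ := riesz_extension K ⟨D, f₀.domRestrict D⟩
    (fun w hw => f₀_nonneg w w.2 hw) (fun ⟨⟨φ, ψ⟩, h, s⟩ => by
      refine ⟨⟨((BoundedContinuousFunction.const E (‖φ‖ + ‖ψ‖ + ‖h‖), 0), (0, |s|)),
        show (0 : E × F →ᵇ ℝ) = 0 from rfl⟩, ?_, fun x y => ?_⟩
      · change 0 ≤ |s| + s
        linarith [neg_abs_le s]
      · rw [ENNReal.ofReal_of_nonpos]
        · exact zero_le
        · change -(‖φ‖ + ‖ψ‖ + ‖h‖ + φ x + (0 + ψ y) + (0 + h (x, y))) ≤ 0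
          have h1 := (abs_le.1 (φ.norm_coe_le_norm x)).1
          have h2 := (abs_le.1 (ψ.norm_coe_le_norm y)).1
          have h3 := (abs_le.1 (h.norm_coe_le_norm (x, y))).1
          linarith)
  have hgf' (φ : E →ᵇ ℝ) (ψ : F →ᵇ ℝ) (s : ℝ) :
      g ((φ, ψ), (0, s)) = ∫ x, φ x ∂μ + ∫ y, ψ y ∂ν + s * S :=
    hgf ⟨((φ, ψ), (0, s)), show (0 : E × F →ᵇ ℝ) = 0 from rfl⟩
  refine ⟨g ∘ₗ LinearMap.inr ℝ _ _ ∘ₗ LinearMap.inl ℝ _ _, fun h hh => ?_, fun φ ψ h hh => ?_,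
    fun h hh => ?_⟩
  · refine hg _ ⟨le_rfl, fun x y => ?_⟩
    change ENNReal.ofReal (-(0 + 0 + h (x, y))) ≤ ENNReal.ofReal 0 * c (x, y)
    simpa using hh (x, y)
  · change g ((0, 0), (h, 0)) = _
    -- Both this vector and its opposite lie in the cone, so the two inequalities give equality.
    have h1 := hg ((φ, ψ), (-h, 0)) ⟨le_rfl, fun x y => by
      change ENNReal.ofReal (-(φ x + ψ y + -h (x, y))) ≤ _
      rw [hh, show -(φ x + ψ y + -(φ x + ψ y)) = 0 by ring]
      simp⟩
    have h2 := hg ((-φ, -ψ), (h, 0)) ⟨le_rfl, fun x y => by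
      change ENNReal.ofReal (-(-φ x + -ψ y + h (x, y))) ≤ _
      rw [hh, show -(-φ x + -ψ y + (φ x + ψ y)) = 0 by ring]
      simp⟩
    have e1 : (((φ, ψ), (-h, 0)) : W) = ((φ, ψ), (0, 0)) - ((0, 0), (h, 0)) := by simp
    have e2 : (((-φ, -ψ), (h, 0)) : W) = ((0, 0), (h, 0)) - ((φ, ψ), (0, 0)) := by simp
    rw [e1, map_sub, hgf'] at h1
    rw [e2, map_sub, hgf'] at h2
    linarith
  · change g ((0, 0), (h, 0)) ≤ _
    have h1 := hg ((0, 0), (-h, 1)) ⟨zero_le_one, fun x y => by simpa using hh (x, y)⟩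
    have e1 : (((0, 0), (-h, 1)) : W) = ((0, 0), (0, 1)) - ((0, 0), (h, 0)) := by simp
    rw [e1, map_sub, hgf'] at h1
    simpa using h1

/-- Kantorovich duality on proper metric spaces, for lower semicontinuous costs. -/
theorem exists_coupling_lintegral_le {E F : Type*} [MetricSpace E] [ProperSpace E]
    [MetricSpace F] [ProperSpace F] [MeasurableSpace E] [BorelSpace E] [MeasurableSpace F]
    [BorelSpace F] {c : E × F → ℝ≥0∞} (hc : LowerSemicontinuous c)
    (μ : Measure E) [IsProbabilityMeasure μ] (ν : Measure F) [IsProbabilityMeasure ν] (S : ℝ)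
    (hS : ∀ (φ : E →ᵇ ℝ) (ψ : F →ᵇ ℝ), (∀ x y, ENNReal.ofReal (φ x + ψ y) ≤ c (x, y)) →
      ∫ x, φ x ∂μ + ∫ y, ψ y ∂ν ≤ S) :
    ∃ γ : Measure (E × F), γ.map Prod.fst = μ ∧ γ.map Prod.snd = ν ∧
      ∫⁻ p, c p ∂γ ≤ ENNReal.ofReal S := by
  obtain ⟨Λ, hpos, hmarg, hle⟩ := exists_functional_of_forall_pair_le c μ ν S hS
  obtain ⟨x₀⟩ : Nonempty E := nonempty_of_isProbabilityMeasure μ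
  obtain ⟨y₀⟩ : Nonempty F := nonempty_of_isProbabilityMeasure ν
  obtain ⟨χ, χs, χ0, χ1, -, χt⟩ := exists_seq_cutoff x₀
  obtain ⟨η, ηs, η0, η1, -, ηt⟩ := exists_seq_cutoff y₀
  let p1 (φ : E →ᵇ ℝ) : E × F →ᵇ ℝ := φ.compContinuous ⟨Prod.fst, continuous_fst⟩
  let p2 (ψ : F →ᵇ ℝ) : E × F →ᵇ ℝ := ψ.compContinuous ⟨Prod.snd, continuous_snd⟩
  have mono {f g : E × F →ᵇ ℝ} (h : ∀ z, f z ≤ g z) : Λ f ≤ Λ g := by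
    have := hpos (g - f) fun z => by simpa using h z
    rw [map_sub] at this
    linarith
  have Λ1 : Λ 1 = 1 := by
    rw [hmarg 1 0 1 (by simp)]
    simp
  obtain ⟨γ, hγ, hrep⟩ := exists_measure_eq_of_tight_functional Λ hpos
    (fun n => p1 (χ n) * p2 (η n))
    (fun n => by
      refine HasCompactSupport.intro ((χs n).isCompact.prod (ηs n).isCompact) fun z hz => ?_
      rw [Set.mem_prod, not_and_or] at hz
      change χ n z.1 * η n z.2 = 0
      rcases hz with hz | hz
      · rw [image_eq_zero_of_notMem_tsupport hz, zero_mul]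
      · rw [image_eq_zero_of_notMem_tsupport hz, mul_zero])
    (fun n z => mul_nonneg (χ0 n _) (η0 n _))
    (fun n z => mul_le_one₀ (χ1 n _) (η0 n _) (η1 n _))
    (fun z => by simpa [p1, p2] using (χt z.1).mul (ηt z.2))
    (by
      have t := ((tendsto_integral_cutoff μ χ0 χ1 χt 1).add
        (tendsto_integral_cutoff ν η0 η1 ηt 1)).sub_const 1
      simp only [BoundedContinuousFunction.coe_one, Pi.one_apply, one_mul, integral_const,
        probReal_univ, smul_eq_mul] at t
      rw [Λ1]
      refine tendsto_of_tendsto_of_tendsto_of_le_of_le (by simpa using t) tendsto_const_nhds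
        (fun n => ?_) (fun n => ?_)
      -- Tightness comes from the marginals: `(1 - χ)(1 - η) ≥ 0` gives `χ η ≥ χ + (η - 1)`, and `Λ`
      -- of the right side is known.
      · have e := hmarg (χ n) (η n - 1) (p1 (χ n) + p2 (η n - 1)) fun x y => rfl
        have e' : ∫ y, (η n - 1) y ∂ν = ∫ y, η n y ∂ν - 1 := by
          simp only [BoundedContinuousFunction.coe_sub, Pi.sub_apply]
          rw [integral_sub ((η n).integrable ν) ((1 : F →ᵇ ℝ).integrable ν)]
          simp
        rw [e', ← add_sub_assoc] at e
        change _ - 1 ≤ _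
        rw [← e]
        refine mono fun z => ?_
        change χ n z.1 + (η n z.2 - 1) ≤ χ n z.1 * η n z.2
        nlinarith [χ1 n z.1, η1 n z.2]
      · rw [← Λ1]
        exact mono fun z => mul_le_one₀ (χ1 n _) (η0 n _) (η1 n _))
  refine ⟨γ, ?_, ?_, ?_⟩
  · refine ext_of_forall_integral_eq_of_IsFiniteMeasure fun φ => ?_
    rw [integral_map (by fun_prop) φ.continuous.measurable.aestronglyMeasurable]
    refine (hrep (p1 φ)).trans ?_
    rw [hmarg φ 0 (p1 φ) (fun x y => by simp [p1])]
    simp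
  · refine ext_of_forall_integral_eq_of_IsFiniteMeasure fun ψ => ?_
    rw [integral_map (by fun_prop) ψ.continuous.measurable.aestronglyMeasurable]
    refine (hrep (p2 ψ)).trans ?_
    rw [hmarg 0 ψ (p2 ψ) (fun x y => by simp [p2])]
    simp
  · exact lintegral_le_of_forall_boundedContinuous_le hc γ S fun h _ hh => by
      rw [hrep]
      exact hle h hh

/-! ### Smooth compactly supported potentials under local coercivity -/

/-- The constraints on the value at each point are convex, so a smooth partition of unity glues
local constants. Approximating from below keeps a pair of potentials admissible. -/
theorem exists_contDiff_hasCompactSupport_mem_Icc {E : Type*} [NormedAddCommGroup E]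
    [NormedSpace ℝ E] [FiniteDimensional ℝ E] {u : E → ℝ} (hu : Continuous u)
    (hs : HasCompactSupport u) {ε : ℝ} (hε : 0 < ε) :
    ∃ v : E → ℝ, ContDiff ℝ ∞ v ∧ HasCompactSupport v ∧ ∀ x, u x - ε ≤ v x ∧ v x ≤ u x := by
  obtain ⟨K, hK, hsK⟩ := exists_compact_superset hs.isCompact
  let t : E → Set ℝ := fun x => {r | r ∈ Set.Icc (u x - ε) (u x) ∧ (x ∉ K → r = 0)}
  have t_conv (x) : Convex ℝ (t x) :=
    (convex_Icc _ _).inter (convex_singleton (0 : ℝ)).setOfPred_const_imp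
  obtain ⟨g, hg⟩ : ∃ g : C^∞⟮𝓘(ℝ, E), E; 𝓘(ℝ, ℝ), ℝ⟯, ∀ x, g x ∈ t x := by
    apply exists_contMDiffMap_forall_mem_convex_of_local 𝓘(ℝ, E) t_conv
    intro x
    by_cases hx : x ∈ tsupport u
    · have h1 : ∀ᶠ y in 𝓝 x, u x - ε / 2 < u y + ε / 2 - ε / 4 :=
        continuousAt_const.eventually_lt (by fun_prop) (by linarith)
      have h2 : ∀ᶠ y in 𝓝 x, u y - ε < u x - ε / 2 :=
        ContinuousAt.eventually_lt (by fun_prop) continuousAt_const (by linarith)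
      have h3 : ∀ᶠ y in 𝓝 x, u x - ε / 2 < u y :=
        continuousAt_const.eventually_lt (by fun_prop) (by linarith)
      have h4 : ∀ᶠ y in 𝓝 x, y ∈ K := mem_interior_iff_mem_nhds.1 (hsK hx)
      exact ⟨_, h2.and (h3.and h4), fun _ => u x - ε / 2, contMDiffOn_const,
        fun y hy => ⟨⟨hy.1.le, hy.2.1.le⟩, fun h => absurd hy.2.2 h⟩⟩
    · refine ⟨(tsupport u)ᶜ, (isClosed_tsupport u).isOpen_compl.mem_nhds hx, fun _ => 0,
        contMDiffOn_const, fun y hy => ⟨?_, fun _ => rfl⟩⟩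
      rw [image_eq_zero_of_notMem_tsupport hy]
      exact ⟨by linarith, le_rfl⟩
  exact ⟨g, g.contMDiff.contDiff, HasCompactSupport.intro hK fun x hx => (hg x).2 hx,
    fun x => (hg x).1⟩

/-- Cutting off an admissible pair when the first factor is a point. -/
theorem exists_cutoff_pair_of_subsingleton {E F : Type*} [TopologicalSpace E] [Subsingleton E]
    [MeasurableSpace E] [MetricSpace F] [ProperSpace F] [MeasurableSpace F] [BorelSpace F]
    {c : E × F → ℝ≥0∞} (μ : Measure E) [IsProbabilityMeasure μ] (ν : Measure F)
    [IsProbabilityMeasure ν] (φ : E →ᵇ ℝ) (ψ : F →ᵇ ℝ)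
    (hadm : ∀ x y, ENNReal.ofReal (φ x + ψ y) ≤ c (x, y)) {ε : ℝ} (hε : 0 < ε) :
    ∃ (f : E → ℝ) (g : F → ℝ), Continuous f ∧ HasCompactSupport f ∧ Continuous g ∧
      HasCompactSupport g ∧ (∀ x y, ENNReal.ofReal (f x + g y) ≤ c (x, y)) ∧ (∀ x, 0 ≤ f x) ∧
      (∃ x, f x ≤ 0) ∧ (∀ x, ENNReal.ofReal (f x) ≤ ⨆ q, c q) ∧ (∃ x, ∀ y, -f x ≤ g y) ∧
      (∃ y, -ε ≤ g y) ∧ ∫ x, φ x ∂μ + ∫ y, ψ y ∂ν - ε ≤ ∫ x, f x ∂μ + ∫ y, g y ∂ν := by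
  obtain ⟨x₀⟩ : Nonempty E := nonempty_of_isProbabilityMeasure μ
  obtain ⟨y₀⟩ : Nonempty F := nonempty_of_isProbabilityMeasure ν
  -- On a one-point space a cut-off never vanishes, so `φ` is instead absorbed into `ψ`. As `c ≥ 0`,
  -- the positive part is still admissible, and cutting off a nonnegative function only lowers it.
  let a : F →ᵇ ℝ := (ψ + BoundedContinuousFunction.const F (φ x₀)) ⊔ 0
  have ha (y) : a y = max (ψ y + φ x₀) 0 := rfl
  obtain ⟨χ, χs, χ0, χ1, -, χt⟩ := exists_seq_cutoff y₀
  obtain ⟨n, hn⟩ := ((tendsto_integral_cutoff ν χ0 χ1 χt a).eventually_const_lt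
    (sub_lt_self _ hε)).exists
  have g0 (y) : 0 ≤ a y * χ n y := mul_nonneg (le_max_right _ _) (χ0 n y)
  refine ⟨0, fun y => a y * χ n y, continuous_zero, HasCompactSupport.zero,
    (a * χ n).continuous, (χs n).mul_left, fun x y => ?_, fun x => le_rfl, ⟨x₀, le_rfl⟩,
    fun x => by simp, ⟨x₀, fun y => by simpa using g0 y⟩, ⟨y₀, by linarith [g0 y₀]⟩, ?_⟩
  · have h1 : (0 : E → ℝ) x + a y * χ n y ≤ a y := by
      have : a y * χ n y ≤ a y := mul_le_of_le_one_right (le_max_right _ _) (χ1 n y)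
      simpa using this
    refine (ENNReal.ofReal_le_ofReal h1).trans ?_
    rw [ha, ENNReal.ofReal_max, ENNReal.ofReal_zero]
    refine max_le ?_ zero_le
    rw [Subsingleton.elim x x₀, add_comm]
    exact hadm x₀ y
  · have h1 : ∫ x, φ x ∂μ = φ x₀ := by
      have : ∀ x, φ x = φ x₀ := fun x => by rw [Subsingleton.elim x x₀]
      simp_rw [this]
      simp
    have h2 : ∫ y, ψ y ∂ν + φ x₀ ≤ ∫ y, a y ∂ν := by
      have : ∫ y, (ψ y + φ x₀) ∂ν ≤ ∫ y, a y ∂ν :=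
        integral_mono ((ψ.integrable ν).add (integrable_const _)) (a.integrable ν)
          fun y => le_max_left _ _
      rw [integral_add (ψ.integrable ν) (integrable_const _)] at this
      simpa using this
    simp only [Pi.zero_apply, integral_zero, zero_add]
    linarith

/-- Cutting off an admissible pair for a locally coercive cost. -/
theorem exists_cutoff_pair_of_coercive {E F : Type*} [NormedAddCommGroup E] [NormedSpace ℝ E]
    [ProperSpace E] [Nontrivial E] [MeasurableSpace E] [BorelSpace E] [NormedAddCommGroup F]
    [ProperSpace F] [MeasurableSpace F] [BorelSpace F] {c : E × F → ℝ≥0∞}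
    (hco : ∀ R > (0 : ℝ), ∀ δ > (0 : ℝ), ∀ M > (0 : ℝ), ∃ R' > (0 : ℝ), ∀ x y, ‖x‖ < R →
      c (x, y) < min ((⨆ η, c (x, η)) - ENNReal.ofReal δ) (ENNReal.ofReal M) → ‖y‖ < R')
    (μ : Measure E) [IsProbabilityMeasure μ] (ν : Measure F)
    [IsProbabilityMeasure ν] (φ : E →ᵇ ℝ) (ψ : F →ᵇ ℝ)
    (hadm : ∀ x y, ENNReal.ofReal (φ x + ψ y) ≤ c (x, y)) {ε : ℝ} (hε : 0 < ε) :
    ∃ (f : E → ℝ) (g : F → ℝ), Continuous f ∧ HasCompactSupport f ∧ Continuous g ∧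
      HasCompactSupport g ∧ (∀ x y, ENNReal.ofReal (f x + g y) ≤ c (x, y)) ∧ (∀ x, 0 ≤ f x) ∧
      (∃ x, f x ≤ 0) ∧ (∀ x, ENNReal.ofReal (f x) ≤ ⨆ q, c q) ∧ (∃ x, ∀ y, -f x ≤ g y) ∧
      (∃ y, -ε ≤ g y) ∧ ∫ x, φ x ∂μ + ∫ y, ψ y ∂ν - ε ≤ ∫ x, f x ∂μ + ∫ y, g y ∂ν := by
  have hψb : BddAbove (Set.range ψ) :=
    ⟨‖ψ‖, by rintro _ ⟨y, rfl⟩; exact (abs_le.1 (ψ.norm_coe_le_norm y)).2⟩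
  set s := sSup (Set.range ψ) with hs
  have hψs (y) : ψ y ≤ s := le_csSup hψb ⟨y, rfl⟩
  have hsψ {r} (h : r < s) : ∃ y, r < ψ y := by
    obtain ⟨_, ⟨y, rfl⟩, hy⟩ := exists_lt_of_lt_csSup (Set.range_nonempty ψ) h
    exact ⟨y, hy⟩
  -- The pair is normalised so that the second potential has supremum `0`; letting `ψ` approach `s`
  -- in the constraint then gives `a x ≤ ⨆ η, c (x, η)`.
  let a : E →ᵇ ℝ := (φ + BoundedContinuousFunction.const E s) ⊔ 0
  let b : F →ᵇ ℝ := ψ - BoundedContinuousFunction.const F s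
  have ha (x) : a x = max (φ x + s) 0 := rfl
  have hb (y) : b y = ψ y - s := rfl
  have ha0 (x) : 0 ≤ a x := le_max_right _ _
  have hb0 (y) : b y ≤ 0 := by linarith [hb y, hψs y]
  have haB (x) : a x ≤ ‖a‖ := (abs_le.1 (a.norm_coe_le_norm x)).2
  have hasup (x) : ENNReal.ofReal (a x) ≤ ⨆ η, c (x, η) := by
    rw [ha, ENNReal.ofReal_max, ENNReal.ofReal_zero]
    refine max_le ?_ zero_le
    by_contra! hlt
    have hC : (⨆ η, c (x, η)) ≠ ⊤ := hlt.ne_top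
    rw [ENNReal.lt_ofReal_iff_toReal_lt hC] at hlt
    obtain ⟨y, hy⟩ := hsψ (show (⨆ η, c (x, η)).toReal - φ x < s by linarith)
    have h1 : ENNReal.ofReal (φ x + ψ y) ≤ ⨆ η, c (x, η) := (hadm x y).trans (le_iSup_of_le y le_rfl)
    rw [ENNReal.ofReal_le_iff_le_toReal hC] at h1
    linarith
  -- One `d` is lost in cutting off `a`, one in subtracting `d` in the definition of `f`.
  set d := ε / 3 with hd
  have hd0 : 0 < d := by positivity
  obtain ⟨χ, χs, χ0, χ1, -, χt⟩ := exists_seq_cutoff (0 : E)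
  obtain ⟨n, hn⟩ := ((tendsto_integral_cutoff μ χ0 χ1 χt a).eventually_const_lt
    (sub_lt_self _ hd0)).exists
  obtain ⟨R, hR⟩ := (χs n).isCompact.isBounded.exists_pos_norm_lt
  -- With this level, `‖x‖ < R` and `‖y‖ ≥ R'` force `c (x, y) ≥ a x - d`, so there the second
  -- potential may be raised to `0`.
  obtain ⟨R', -, hR'⟩ := hco R hR.1 d hd0 (‖a‖ + 1) (by positivity)
  obtain ⟨η, ηs, η0, η1, ηe, -⟩ := exists_seq_cutoff (0 : F)
  obtain ⟨N, hN⟩ := exists_nat_ge R'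
  let f : E → ℝ := fun x => max (a x * χ n x - d) 0
  have fc : Continuous f := ((a * χ n).continuous.sub continuous_const).max continuous_const
  have f0 (x) : 0 ≤ f x := le_max_right _ _
  have fz (x) (hx : x ∉ tsupport (χ n)) : f x = 0 := by
    simp only [f]
    rw [image_eq_zero_of_notMem_tsupport hx]
    simp [hd0.le]
  have fs : HasCompactSupport f := HasCompactSupport.intro (χs n).isCompact fz
  have fa (x) : f x ≤ max (a x - d) 0 := by
    refine max_le_max_right _ ?_
    linarith [mul_le_of_le_one_right (ha0 x) (χ1 n x)]
  obtain ⟨x₁, hx₁⟩ : ∃ x₁, ∀ x, f x ≤ f x₁ := fc.exists_forall_ge_of_hasCompactSupport fs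
  let g₁ : F → ℝ := fun y => b y * η N y
  -- Truncation at `-max f` gives the lower bound on `g` and is harmless: where it acts, `f x + g y
  -- ≤ 0`.
  let g : F → ℝ := fun y => max (g₁ y) (-f x₁)
  have g₁b (y) : b y ≤ g₁ y := by
    simp only [g₁]
    nlinarith [hb0 y, η1 N y]
  have g₁0 (y) : g₁ y ≤ 0 := mul_nonpos_of_nonpos_of_nonneg (hb0 y) (η0 N y)
  have gb (y) : b y ≤ g y := (g₁b y).trans (le_max_left _ _)
  have gc : Continuous g := ((b * η N).continuous).max continuous_const
  have gs : HasCompactSupport g := by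
    refine HasCompactSupport.intro (ηs N).isCompact fun y hy => ?_
    simp only [g, g₁]
    rw [image_eq_zero_of_notMem_tsupport hy, mul_zero]
    exact max_eq_left (by linarith [f0 x₁])
  have key (x y) : ENNReal.ofReal (f x + g₁ y) ≤ c (x, y) := by
    rcases (f0 x).eq_or_lt with hf | hf
    · rw [ENNReal.ofReal_of_nonpos (by linarith [g₁0 y])]
      exact zero_le
    have hax : 0 < a x - d := by
      by_contra! h
      exact absurd (fa x) (by rw [max_eq_right h]; exact not_le.2 hf)
    have hfa : f x ≤ a x - d := by simpa [hax.le] using fa x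
    rcases lt_or_ge ‖y‖ R' with hy | hy
    · have e1 : g₁ y = b y := by
        simp only [g₁]
        rw [ηe N y (by simpa using (hy.le.trans hN)), mul_one]
      have e2 : a x = φ x + s := by
        rw [ha, max_eq_left]
        by_contra! h
        have := ha x
        rw [max_eq_right h.le] at this
        linarith
      refine le_trans (ENNReal.ofReal_le_ofReal ?_) (hadm x y)
      linarith [hb y]
    · have hxR : ‖x‖ < R := by
        refine hR.2 x ?_
        by_contra hx
        exact hf.ne' (fz x hx)
      have hle := not_lt.1 fun h => hy.not_gt (hR' x y hxR h)
      refine le_trans (le_min ?_ ?_) hle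
      · refine le_trans (ENNReal.ofReal_le_ofReal (show f x + g₁ y ≤ a x - d by linarith [g₁0 y])) ?_
        rw [ENNReal.ofReal_sub _ hd0.le]
        exact tsub_le_tsub_right (hasup x) _
      · exact ENNReal.ofReal_le_ofReal (by linarith [g₁0 y, haB x])
  refine ⟨f, g, fc, fs, gc, gs, fun x y => ?_, f0, ?_, fun x => ?_, ⟨x₁, fun y => le_max_right _ _⟩,
    ?_, ?_⟩
  · rcases le_total (g₁ y) (-f x₁) with h | h
    · have : g y = -f x₁ := max_eq_right h
      rw [this, ENNReal.ofReal_of_nonpos (by linarith [hx₁ x])]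
      exact zero_le
    · have : g y = g₁ y := max_eq_left h
      rw [this]
      exact key x y
  -- A nonzero space is not compact, so the cut-off vanishes somewhere.
  · have : NoncompactSpace E := NormedSpace.noncompactSpace ℝ E
    obtain ⟨x, hx⟩ := (Set.ne_univ_iff_exists_notMem _).1 (χs n).isCompact.ne_univ
    exact ⟨x, (fz x hx).le⟩
  · have h1 : f x ≤ a x := (fa x).trans (max_le (by linarith) (ha0 x))
    refine (ENNReal.ofReal_le_ofReal h1).trans ((hasup x).trans ?_)
    exact iSup_le fun y => le_iSup_of_le (x, y) le_rfl
  · obtain ⟨y, hy⟩ := hsψ (sub_lt_self s hε)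
    exact ⟨y, by linarith [gb y, hb y]⟩
  · have i1 : ∫ x, φ x ∂μ + s ≤ ∫ x, a x ∂μ := by
      have : ∫ x, (φ x + s) ∂μ ≤ ∫ x, a x ∂μ :=
        integral_mono ((φ.integrable μ).add (integrable_const _)) (a.integrable μ)
          fun y => le_max_left _ _
      rw [integral_add (φ.integrable μ) (integrable_const _)] at this
      simpa using this
    have i2 : ∫ y, b y ∂ν = ∫ y, ψ y ∂ν - s := by
      simp_rw [hb]
      rw [integral_sub (ψ.integrable ν) (integrable_const _)]
      simp
    have i3 : ∫ y, b y ∂ν ≤ ∫ y, g y ∂ν :=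
      integral_mono (b.integrable ν) (gc.integrable_of_hasCompactSupport gs) gb
    have i4 : ∫ x, a x * χ n x ∂μ - d ≤ ∫ x, f x ∂μ := by
      have : ∫ x, (a x * χ n x - d) ∂μ ≤ ∫ x, f x ∂μ :=
        integral_mono (((a * χ n).integrable μ).sub (integrable_const _))
          (fc.integrable_of_hasCompactSupport fs) fun x => le_max_left _ _
      have e := integral_sub ((a * χ n).integrable μ) (integrable_const (μ := μ) d)
      simp only [BoundedContinuousFunction.coe_mul, Pi.mul_apply] at e
      rw [e] at this
      simpa using this
    linarith

/-- Every admissible pair of bounded continuous functions for a locally coercive cost can be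
replaced, with a small loss, by a pair of smooth compactly supported functions subject to relaxed
bounds. -/
theorem LocallyCoercive.exists_smooth_pair {m n : ℕ}
    {c : EuclideanSpace ℝ (Fin m) × EuclideanSpace ℝ (Fin n) → ℝ≥0∞} (hco : LocallyCoercive c)
    (μ : Measure (EuclideanSpace ℝ (Fin m))) [IsProbabilityMeasure μ]
    (ν : Measure (EuclideanSpace ℝ (Fin n))) [IsProbabilityMeasure ν]
    (φ : EuclideanSpace ℝ (Fin m) →ᵇ ℝ) (ψ : EuclideanSpace ℝ (Fin n) →ᵇ ℝ)
    (hadm : ∀ x y, ENNReal.ofReal (φ x + ψ y) ≤ c (x, y)) {δ ε : ℝ} (hδ : 0 < δ) (hε : 0 < ε) :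
    ∃ (f : EuclideanSpace ℝ (Fin m) → ℝ) (g : EuclideanSpace ℝ (Fin n) → ℝ),
      ContDiff ℝ ∞ f ∧ HasCompactSupport f ∧ ContDiff ℝ ∞ g ∧ HasCompactSupport g ∧
      (∀ x y, ENNReal.ofReal (f x + g y) ≤ c (x, y)) ∧ (∀ x, -δ ≤ f x) ∧ (∃ x, f x ≤ 0) ∧
      (∀ x, ENNReal.ofReal (f x) ≤ ⨆ q, c q) ∧ (∃ x, ∀ y, -f x - δ ≤ g y) ∧ (∃ y, -δ ≤ g y) ∧
      ∫ x, φ x ∂μ + ∫ y, ψ y ∂ν - ε ≤ ∫ x, f x ∂μ + ∫ y, g y ∂ν := by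
  -- The integrals lose `t` three times, once in the cut-off and once in smoothing each potential;
  -- the pointwise bounds lose at most `2 * t`.
  set t := min (δ / 2) (ε / 3) with ht
  have ht0 : 0 < t := by positivity
  have htδ : t ≤ δ / 2 := min_le_left _ _
  have htε : t ≤ ε / 3 := min_le_right _ _
  obtain ⟨f, g, fc, fs, gc, gs, h1, h2, ⟨x₁, h3⟩, h4, ⟨x₂, h5⟩, ⟨y₁, h6⟩, h7⟩ :
      ∃ (f : EuclideanSpace ℝ (Fin m) → ℝ) (g : EuclideanSpace ℝ (Fin n) → ℝ), Continuous f ∧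
        HasCompactSupport f ∧ Continuous g ∧ HasCompactSupport g ∧
        (∀ x y, ENNReal.ofReal (f x + g y) ≤ c (x, y)) ∧ (∀ x, 0 ≤ f x) ∧ (∃ x, f x ≤ 0) ∧
        (∀ x, ENNReal.ofReal (f x) ≤ ⨆ q, c q) ∧ (∃ x, ∀ y, -f x ≤ g y) ∧
        (∃ y, -t ≤ g y) ∧ ∫ x, φ x ∂μ + ∫ y, ψ y ∂ν - t ≤ ∫ x, f x ∂μ + ∫ y, g y ∂ν := by
    rcases subsingleton_or_nontrivial (EuclideanSpace ℝ (Fin m)) with _ | _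
    · exact exists_cutoff_pair_of_subsingleton μ ν φ ψ hadm ht0
    · exact exists_cutoff_pair_of_coercive hco μ ν φ ψ hadm ht0
  obtain ⟨u, uc, us, hu⟩ := exists_contDiff_hasCompactSupport_mem_Icc fc fs ht0
  obtain ⟨v, vc, vs, hv⟩ := exists_contDiff_hasCompactSupport_mem_Icc gc gs ht0
  refine ⟨u, v, uc, us, vc, vs, fun x y => ?_, fun x => ?_, ⟨x₁, (hu x₁).2.trans h3⟩, fun x => ?_,
    ⟨x₂, fun y => ?_⟩, ⟨y₁, ?_⟩, ?_⟩
  · exact (ENNReal.ofReal_le_ofReal (add_le_add (hu x).2 (hv y).2)).trans (h1 x y)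
  · linarith [(hu x).1, h2 x]
  · exact (ENNReal.ofReal_le_ofReal (hu x).2).trans (h4 x)
  · linarith [(hu x₂).1, (hv y).1, h5 y]
  · linarith [(hv y₁).1]
  · have i1 : ∫ x, f x ∂μ - t ≤ ∫ x, u x ∂μ := by
      have : ∫ x, (f x - t) ∂μ ≤ ∫ x, u x ∂μ :=
        integral_mono ((fc.integrable_of_hasCompactSupport fs).sub (integrable_const _))
          (uc.continuous.integrable_of_hasCompactSupport us) fun x => (hu x).1
      rw [integral_sub (fc.integrable_of_hasCompactSupport fs) (integrable_const _)] at this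
      simpa using this
    have i2 : ∫ y, g y ∂ν - t ≤ ∫ y, v y ∂ν := by
      have : ∫ y, (g y - t) ∂ν ≤ ∫ y, v y ∂ν :=
        integral_mono ((gc.integrable_of_hasCompactSupport gs).sub (integrable_const _))
          (vc.continuous.integrable_of_hasCompactSupport vs) fun y => (hv y).1
      rw [integral_sub (gc.integrable_of_hasCompactSupport gs) (integrable_const _)] at this
      simpa using this
    linarith

/-! ### Transfer to cylindrical potentials -/

theorem EReal.coe_le_coe_ennreal_of_ofReal_le {a : ℝ} {b : ℝ≥0∞} (h : ENNReal.ofReal a ≤ b) :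
    (a : EReal) ≤ (b : EReal) := by
  refine le_trans ?_ (EReal.coe_ennreal_le_coe_ennreal_iff.2 h)
  rw [EReal.coe_ennreal_ofReal]
  exact_mod_cast le_max_left _ _

theorem EReal.coe_ennreal_iSup_le {ι : Type*} [Nonempty ι] (f : ι → ℝ≥0∞) :
    ((⨆ i, f i : ℝ≥0∞) : EReal) ≤ ⨆ i, (f i : EReal) := by
  rw [Monotone.map_ciSup_of_continuousAt continuous_coe_ennreal_ereal.continuousAt
    (fun _ _ h => EReal.coe_ennreal_le_coe_ennreal_iff.2 h)]

/-- Duality for a cost depending on finite dimensional projections, with smooth cylindrical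
potentials. -/
theorem exists_plan_of_iSup_cylindrical_le {X Y : Type*}
    [AddCommGroup X] [Module ℝ X] [TopologicalSpace X] [MeasurableSpace X] [BorelSpace X]
    [AddCommGroup Y] [Module ℝ Y] [TopologicalSpace Y] [MeasurableSpace Y] [BorelSpace Y]
    [SecondCountableTopology X] [SecondCountableTopology Y]
    (P : X →L[ℝ] X) (Q : Y →L[ℝ] Y) (c : X × Y → ℝ≥0∞) (hc : LowerSemicontinuous c)
    (hcoer : LocallyCoerciveOn c
      (LinearMap.range (P : X →ₗ[ℝ] X)) (LinearMap.range (Q : Y →ₗ[ℝ] Y)))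
    (μ : Measure X) [IsProbabilityMeasure μ] (ν : Measure Y) [IsProbabilityMeasure ν]
    (δ : ℝ) (hδ : 0 < δ) (S : ℝ)
    (hS : (⨆ p ∈ relaxedPairs (fun q : X × Y => c (P q.1, Q q.2)) μ ν δ ∩ (Cyl P ×ˢ Cyl Q),
      ((∫ x, p.1 x ∂μ + ∫ y, p.2 y ∂ν : ℝ) : EReal)) ≤ (S : EReal)) :
    0 ≤ S ∧ ∃ γ : Measure (X × Y), γ.map Prod.fst = μ.map P ∧ γ.map Prod.snd = ν.map Q ∧
      ∫⁻ p, c p ∂γ ≤ ENNReal.ofReal S := by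
  obtain ⟨m, n, ι, κ, hco⟩ := hcoer
  set c₀ : EuclideanSpace ℝ (Fin m) × EuclideanSpace ℝ (Fin n) → ℝ≥0∞ :=
    fun p => c ((ι.symm p.1 : X), (κ.symm p.2 : Y)) with hc₀
  let T : X → EuclideanSpace ℝ (Fin m) :=
    fun x => ι ⟨P x, LinearMap.mem_range_self (P : X →ₗ[ℝ] X) x⟩
  let U : Y → EuclideanSpace ℝ (Fin n) :=
    fun y => κ ⟨Q y, LinearMap.mem_range_self (Q : Y →ₗ[ℝ] Y) y⟩
  let j : EuclideanSpace ℝ (Fin m) → X := fun e => (ι.symm e : X)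
  let k : EuclideanSpace ℝ (Fin n) → Y := fun e => (κ.symm e : Y)
  have Tc : Continuous T := ι.continuous.comp (P.continuous.subtype_mk _)
  have Uc : Continuous U := κ.continuous.comp (Q.continuous.subtype_mk _)
  have jc : Continuous j := continuous_subtype_val.comp ι.symm.continuous
  have kc : Continuous k := continuous_subtype_val.comp κ.symm.continuous
  have jT (x) : j (T x) = P x := by simp [j, T]
  have kU (y) : k (U y) = Q y := by simp [k, U]
  -- Surjectivity of the coordinate maps carries the sup and inf constraints from Euclidean space
  -- back to `X` and `Y`.
  have Ts : Function.Surjective T := fun e => by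
    obtain ⟨x, hx⟩ := (ι.symm e).2
    refine ⟨x, ?_⟩
    rw [← ι.apply_symm_apply e]
    exact congrArg ι (Subtype.ext hx)
  have Us : Function.Surjective U := fun e => by
    obtain ⟨x, hx⟩ := (κ.symm e).2
    refine ⟨x, ?_⟩
    rw [← κ.apply_symm_apply e]
    exact congrArg κ (Subtype.ext hx)
  have c₀TU (x y) : c₀ (T x, U y) = c (P x, Q y) := by
    change c (j (T x), k (U y)) = _
    rw [jT, kU]
  have : IsProbabilityMeasure (μ.map T) := Measure.isProbabilityMeasure_map Tc.aemeasurable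
  have : IsProbabilityMeasure (ν.map U) := Measure.isProbabilityMeasure_map Uc.aemeasurable
  have hpair (φ : EuclideanSpace ℝ (Fin m) →ᵇ ℝ) (ψ : EuclideanSpace ℝ (Fin n) →ᵇ ℝ)
      (hadm : ∀ x y, ENNReal.ofReal (φ x + ψ y) ≤ c₀ (x, y)) :
      ∫ x, φ x ∂(μ.map T) + ∫ y, ψ y ∂(ν.map U) ≤ S := by
    refine le_of_forall_pos_le_add fun ε hε => ?_
    obtain ⟨f, g, fc, fs, gc, gs, h1, h2, ⟨x₁, h3⟩, h4, ⟨x₂, h5⟩, ⟨y₁, h6⟩, h7⟩ :=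
      hco.exists_smooth_pair (μ.map T) (ν.map U) φ ψ hadm hδ hε
    obtain ⟨x₁, rfl⟩ := Ts x₁
    obtain ⟨x₂, rfl⟩ := Ts x₂
    obtain ⟨y₁, rfl⟩ := Us y₁
    have hmem : (f ∘ T, g ∘ U) ∈ relaxedPairs (fun q : X × Y => c (P q.1, Q q.2)) μ ν δ ∩
        (Cyl P ×ˢ Cyl Q) := by
      refine ⟨⟨⟨?_, ?_, Set.univ, univ_mem, Set.univ, univ_mem, fun x _ y _ => ?_⟩,
        fc.continuous.comp Tc, ?_, gc.continuous.comp Uc, ?_, ?_, ?_, ?_, fun y => ?_, ?_⟩, ?_, ?_⟩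
      · exact (fc.continuous.integrable_of_hasCompactSupport fs).comp_measurable Tc.measurable
      · exact (gc.continuous.integrable_of_hasCompactSupport gs).comp_measurable Uc.measurable
      · refine EReal.coe_le_coe_ennreal_of_ofReal_le ?_
        change _ ≤ c (P x, Q y)
        rw [← c₀TU]
        exact h1 _ _
      · obtain ⟨C, hC⟩ := fs.exists_bound_of_continuous fc.continuous
        exact ⟨C, fun x => hC _⟩
      · obtain ⟨C, hC⟩ := gs.exists_bound_of_continuous gc.continuous
        exact ⟨C, fun x => hC _⟩
      · exact le_iInf fun x => EReal.coe_le_coe_iff.2 (h2 _)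
      · exact iInf_le_of_le x₁ (EReal.coe_le_coe_iff.2 h3)
      · refine iSup_le fun x => (EReal.coe_le_coe_ennreal_of_ofReal_le (h4 (T x))).trans ?_
        refine (EReal.coe_ennreal_iSup_le _).trans (iSup_le fun ⟨e, e'⟩ => ?_)
        obtain ⟨x, rfl⟩ := Ts e
        obtain ⟨y, rfl⟩ := Us e'
        rw [c₀TU]
        exact le_iSup_of_le (x, y) le_rfl
      · have h : ((f (T x₂) : ℝ) : EReal) ≤ ⨆ x, ((f ∘ T) x : EReal) := le_iSup_of_le x₂ le_rfl
        refine (EReal.sub_le_sub (EReal.neg_le_neg_iff.2 h) le_rfl).trans ?_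
        exact_mod_cast h5 (U y)
      · exact le_iSup_of_le y₁ (EReal.coe_le_coe_iff.2 h6)
      · exact ⟨m, ι, f, fc, fs, fun x => rfl⟩
      · exact ⟨n, κ, g, gc, gs, fun x => rfl⟩
    have h8 : ∫ x, f (T x) ∂μ + ∫ y, g (U y) ∂ν ≤ S :=
      EReal.coe_le_coe_iff.1 ((le_iSup₂_of_le _ hmem le_rfl).trans hS)
    rw [integral_map Tc.aemeasurable fc.continuous.measurable.aestronglyMeasurable,
      integral_map Uc.aemeasurable gc.continuous.measurable.aestronglyMeasurable] at h7
    linarith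
  -- The zero pair is admissible because `c ≥ 0`.
  refine ⟨by simpa using hpair 0 0 (by simp), ?_⟩
  have c₀lsc : LowerSemicontinuous c₀ :=
    hc.comp (g := fun p : _ × _ => (j p.1, k p.2)) (by fun_prop)
  obtain ⟨γ, hγ1, hγ2, hγ3⟩ := exists_coupling_lintegral_le c₀lsc (μ.map T) (ν.map U) S hpair
  have hm : Measurable (Prod.map j k) := jc.measurable.prodMap kc.measurable
  refine ⟨γ.map (Prod.map j k), ?_, ?_, ?_⟩
  · rw [Measure.map_map measurable_fst hm]
    change γ.map (j ∘ Prod.fst) = _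
    rw [← Measure.map_map jc.measurable measurable_fst, hγ1, Measure.map_map jc.measurable
      Tc.measurable]
    exact congrArg μ.map (funext jT)
  · rw [Measure.map_map measurable_snd hm]
    change γ.map (k ∘ Prod.snd) = _
    rw [← Measure.map_map kc.measurable measurable_snd, hγ2, Measure.map_map kc.measurable
      Uc.measurable]
    exact congrArg ν.map (funext kU)
  · rw [lintegral_map hc.measurable hm]
    exact hγ3

/-! ### Weak limits of plans and conclusion -/

/-- Stability of transport plans under weak convergence of the marginals. -/
theorem transportCost_le_of_tendsto {X Y : Type*} [TopologicalSpace X] [PolishSpace X]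
    [MeasurableSpace X] [BorelSpace X] [TopologicalSpace Y] [PolishSpace Y] [MeasurableSpace Y]
    [BorelSpace Y] {c : X × Y → ℝ≥0∞} (hc : LowerSemicontinuous c)
    {μs : ℕ → ProbabilityMeasure X} {μ : ProbabilityMeasure X} (hμ : Tendsto μs atTop (𝓝 μ))
    {νs : ℕ → ProbabilityMeasure Y} {ν : ProbabilityMeasure Y} (hν : Tendsto νs atTop (𝓝 ν))
    {γs : ℕ → Measure (X × Y)} (h1 : ∀ n, (γs n).map Prod.fst = μs n)
    (h2 : ∀ n, (γs n).map Prod.snd = νs n) {S : ℝ} (hS0 : 0 ≤ S)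
    (hS : ∀ n, ∫⁻ p, c p ∂(γs n) ≤ ENNReal.ofReal S) :
    transportCost c (μ : Measure X) (ν : Measure Y) ≤ ENNReal.ofReal S := by
  let := TopologicalSpace.upgradeIsCompletelyMetrizable X
  let := TopologicalSpace.upgradeIsCompletelyMetrizable Y
  have prob (n) : IsProbabilityMeasure (γs n) := by
    have : IsProbabilityMeasure ((γs n).map Prod.fst) := by rw [h1]; infer_instance
    exact Measure.isProbabilityMeasure_of_map Prod.fst
  let Γ : ℕ → ProbabilityMeasure (X × Y) := fun n => ⟨γs n, prob n⟩
  -- A convergent sequence together with its limit is compact, hence tight by Prokhorov's theorem;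
  -- tight marginals make the plans tight.
  have tX : IsTightMeasureSet {((ρ : ProbabilityMeasure X) : Measure X) | ρ ∈ Set.range μs} :=
    isTightMeasureSet_of_isCompact_closure (hμ.isCompact_insert_range.closure_of_subset
      (Set.subset_insert _ _))
  have tY : IsTightMeasureSet {((ρ : ProbabilityMeasure Y) : Measure Y) | ρ ∈ Set.range νs} :=
    isTightMeasureSet_of_isCompact_closure (hν.isCompact_insert_range.closure_of_subset
      (Set.subset_insert _ _))
  have tΓ : IsTightMeasureSet
      {((ρ : ProbabilityMeasure (X × Y)) : Measure (X × Y)) | ρ ∈ Set.range Γ} := by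
    refine IsTightMeasureSet.prodMk (tX.subset ?_) (tY.subset ?_)
    · rintro _ ⟨_, ⟨_, ⟨n, rfl⟩, rfl⟩, rfl⟩
      exact ⟨μs n, ⟨n, rfl⟩, (h1 n).symm⟩
    · rintro _ ⟨_, ⟨_, ⟨n, rfl⟩, rfl⟩, rfl⟩
      exact ⟨νs n, ⟨n, rfl⟩, (h2 n).symm⟩
  obtain ⟨γ, -, σ, hσ, hγ⟩ := (isCompact_closure_of_isTightMeasureSet tΓ).isSeqCompact
    (fun n => subset_closure (Set.mem_range_self n))
  have m1 : γ.map continuous_fst.measurable.aemeasurable = μ := by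
    refine tendsto_nhds_unique (ProbabilityMeasure.tendsto_map_of_tendsto_of_continuous _ _ hγ
      continuous_fst) ?_
    refine (hμ.comp hσ.tendsto_atTop).congr fun n => Subtype.ext (h1 _).symm
  have m2 : γ.map continuous_snd.measurable.aemeasurable = ν := by
    refine tendsto_nhds_unique (ProbabilityMeasure.tendsto_map_of_tendsto_of_continuous _ _ hγ
      continuous_snd) ?_
    refine (hν.comp hσ.tendsto_atTop).congr fun n => Subtype.ext (h2 _).symm
  refine iInf₂_le_of_le (γ : Measure (X × Y))
    (show _ ∧ _ from ⟨congrArg Subtype.val m1, congrArg Subtype.val m2⟩) ?_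
  -- Weak convergence applies to each bounded continuous `h ≤ c`, and the integral of `c` is
  -- recovered from these.
  refine lintegral_le_of_forall_boundedContinuous_le hc _ S fun h h0 hh => ?_
  refine le_of_tendsto (ProbabilityMeasure.tendsto_iff_forall_integral_tendsto.1 hγ h)
    (.of_forall fun n => ?_)
  rw [← ENNReal.ofReal_le_ofReal_iff hS0,
    ofReal_integral_eq_lintegral_ofReal (h.integrable _) (.of_forall h0)]
  exact (lintegral_mono hh).trans (hS (σ n))

/-- A Fréchet space whose identity is a pointwise limit of operators of finite rank is Polish. -/
theorem IsFrechetSpace.polishSpace {X : Type*} [AddCommGroup X] [Module ℝ X] [TopologicalSpace X]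
    [IsFrechetSpace X] (P : ℕ → X →L[ℝ] X)
    (hPfin : ∀ k, FiniteDimensional ℝ (LinearMap.range (P k : X →ₗ[ℝ] X)))
    (hP : ∀ x, Tendsto (fun k => P k x) atTop (𝓝 x)) : PolishSpace X := by
  obtain ⟨m, hm, -, hcomp⟩ := IsFrechetSpace.exists_metric (X := X)
  have : TopologicalSpace.IsCompletelyMetrizableSpace X := ⟨m, hm, hcomp⟩
  -- The ranges of the `P k` are images of Euclidean spaces, and their countable union is dense by
  -- pointwise convergence.
  have hsep : TopologicalSpace.IsSeparable (Set.univ : Set X) := by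
    refine (TopologicalSpace.IsSeparable.iUnion fun k => ?_ :
      TopologicalSpace.IsSeparable (⋃ k, Set.range (P k))).closure.mono fun x _ => ?_
    · have e : Set.range (P k) = Set.range (fun v => (((toEuclidean (E :=
          LinearMap.range (P k : X →ₗ[ℝ] X))).symm v : LinearMap.range (P k : X →ₗ[ℝ] X)) : X)) := by
        ext x
        constructor
        · rintro ⟨z, rfl⟩
          exact ⟨toEuclidean ⟨P k z, LinearMap.mem_range_self (P k : X →ₗ[ℝ] X) z⟩, by simp⟩
        · rintro ⟨v, rfl⟩
          exact (toEuclidean.symm v : LinearMap.range (P k : X →ₗ[ℝ] X)).2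
      rw [e]
      exact TopologicalSpace.isSeparable_range
        (continuous_subtype_val.comp (ContinuousLinearEquiv.continuous _))
    · exact mem_closure_of_tendsto (hP x) (.of_forall fun k => Set.mem_iUnion.2 ⟨k, x, rfl⟩)
  have : TopologicalSpace.SeparableSpace X := TopologicalSpace.isSeparable_univ_iff.1 hsep
  infer_instance

/-- The images of a probability measure under continuous maps converging pointwise to the identity
converge weakly. -/
theorem tendsto_map_of_tendsto_id {X : Type*} [TopologicalSpace X] [MeasurableSpace X]
    [BorelSpace X] (μ : ProbabilityMeasure X) {T : ℕ → X → X} (hT : ∀ k, Continuous (T k))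
    (h : ∀ x, Tendsto (fun k => T k x) atTop (𝓝 x)) :
    Tendsto (fun k => μ.map (hT k).measurable.aemeasurable) atTop (𝓝 μ) := by
  refine ProbabilityMeasure.tendsto_iff_forall_integral_tendsto.2 fun f => ?_
  have e (k) : ∫ x, f x ∂(μ.map (hT k).measurable.aemeasurable : Measure X) =
      ∫ x, f (T k x) ∂(μ : Measure X) :=
    integral_map (hT k).measurable.aemeasurable f.continuous.measurable.aestronglyMeasurable
  simp_rw [e]
  refine tendsto_integral_of_dominated_convergence (fun _ => ‖f‖)
    (fun k => (f.continuous.comp (hT k)).measurable.aestronglyMeasurable) (integrable_const _)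
    (fun k => .of_forall fun x => f.norm_coe_le_norm _)
    (.of_forall fun x => (f.continuous.tendsto x).comp (h x))

theorem theorem3 {X Y : Type*}
    [AddCommGroup X] [Module ℝ X] [TopologicalSpace X] [IsFrechetSpace X]
    [MeasurableSpace X] [BorelSpace X]
    [AddCommGroup Y] [Module ℝ Y] [TopologicalSpace Y] [IsFrechetSpace Y]
    [MeasurableSpace Y] [BorelSpace Y]
    (P : ℕ → X →L[ℝ] X) (Q : ℕ → Y →L[ℝ] Y)
    (hPfin : ∀ k, FiniteDimensional ℝ (LinearMap.range (P k : X →ₗ[ℝ] X)))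
    (hQfin : ∀ k, FiniteDimensional ℝ (LinearMap.range (Q k : Y →ₗ[ℝ] Y)))
    (hP : ∀ x, Tendsto (fun k => P k x) atTop (𝓝 x))
    (hQ : ∀ y, Tendsto (fun k => Q k y) atTop (𝓝 y))
    (c : X × Y → ℝ≥0∞) (hc : LowerSemicontinuous c)
    (hcoer : ∀ k, LocallyCoerciveOn c
      (LinearMap.range (P k : X →ₗ[ℝ] X)) (LinearMap.range (Q k : Y →ₗ[ℝ] Y)))
    (μ : Measure X) [IsProbabilityMeasure μ] (ν : Measure Y) [IsProbabilityMeasure ν]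
    (δ : ℝ) (hδ : 0 < δ) :
    (transportCost c μ ν : EReal) ≤
      liminf (fun k : ℕ =>
        ⨆ p ∈ relaxedPairs (fun q : X × Y => c (P k q.1, Q k q.2)) μ ν δ ∩
            (Cyl (P k) ×ˢ Cyl (Q k)),
          ((∫ x, p.1 x ∂μ + ∫ y, p.2 y ∂ν : ℝ) : EReal)) atTop := by
  have := IsFrechetSpace.polishSpace P hPfin hP
  have := IsFrechetSpace.polishSpace Q hQfin hQ
  -- A real `a` strictly between the two sides bounds the dual values along a subsequence, which is
  -- all the limit argument needs.
  by_contra! hlt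
  obtain ⟨a, ha, ha'⟩ := EReal.lt_iff_exists_real_btwn.1 hlt
  obtain ⟨σ, hσ, hσa⟩ := extraction_of_frequently_atTop
    (frequently_lt_of_liminf_lt (by isBoundedDefault) ha)
  have plan (n) := exists_plan_of_iSup_cylindrical_le (P (σ n)) (Q (σ n)) c hc (hcoer _) μ ν δ hδ a
    (hσa n).le
  have a0 : 0 ≤ a := (plan 0).1
  choose γ hγ1 hγ2 hγ3 using fun n => (plan n).2
  have hle := transportCost_le_of_tendsto hc
    ((tendsto_map_of_tendsto_id ⟨μ, inferInstance⟩ (fun k => (P k).continuous) hP).comp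
      hσ.tendsto_atTop)
    ((tendsto_map_of_tendsto_id ⟨ν, inferInstance⟩ (fun k => (Q k).continuous) hQ).comp
      hσ.tendsto_atTop) hγ1 hγ2 a0 hγ3
  refine absurd ha' (not_lt.2 ((EReal.coe_ennreal_le_coe_ennreal_iff.2 hle).trans ?_))
  rw [EReal.coe_ennreal_ofReal, max_eq_left a0]
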